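/- Let $G$ be a (discrete) abelian group, written additively, and let $S\subseteq G$ be a positive cone, i.e. a submonoid such that $S\cap(-S)=\{0\}$ and every $g\in G$ has the form $g=s-t$ with $s,t\in S$. For $s\in S$ let $V_s$ be the isometry of $\ell^2(S)$ with $V_s e_t=e_{s+t}$, and let $\mathcal A(S)\subseteq\mathcal B(\ell^2(S))$ be the norm-closed algebra generated by $\{V_s: s\in S\}$. For $g\in G$ let $U_g$ be the unitary on $\ell^2(G)$ with $U_g e_h=e_{g+h}$, and let $\mathrm C^*(G)\subseteq\mathcal B(\ell^2(G))$ be the reduced group C*-algebra, i.e. the C*-algebra generated by $\{U_g: g\in G\}$. Then $\mathrm C^*(G)$ is the C*-envelope of $\mathcal A(S)$, via $V_s\mapsto U_s$. That is, there is a homomorphism $i\colon\mathcal A(S)\to\mathrm C^*(G)$ with $i(V_s)=U_s$ for all $s\in S$ such that: (i) $i$ is completely isometric and $\mathrm C^*(G)$ is generated as a C*-algebra by $i(\mathcal A(S))$; (ii) for every C*-algebra $D$ and every completely isometric homomorphism $j\colon\mathcal A(S)\to D$ such that $D$ is generated as a C*-algebra by $j(\mathcal A(S))$, there is a unique surjective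 $*$-homomorphism $\Phi\colon D\to\mathrm C^*(G)$ with $\Phi\circ j=i$. -/

import Mathlib

universe u v w

/-- A positive cone of an abelian group `G`: a unital subsemigroup `S` with `S ∩ (-S) = {0}`
and such that every element of `G` is a difference of two elements of `S`. -/
structure IsPositiveCone {G : Type u} [AddCommGroup G] (S : AddSubmonoid G) : Prop where
  eq_zero_of_neg_mem : ∀ g ∈ S, -g ∈ S → g = 0
  exists_sub : ∀ g : G, ∃ s ∈ S, ∃ t ∈ S, g = s - t

/-- The Hilbert space `ℓ²(P)`. -/
abbrev EllTwo (P : Type u) : Type u := lp (fun _ : P => ℂ) 2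

section Fock

open Classical in
/-- The standard basis vector `e_p` of `ℓ²(P)`. -/
noncomputable def ellTwoBasis {P : Type u} (p : P) : EllTwo P := lp.single 2 p (1 : ℂ)

theorem orthonormal_ellTwoBasis (P : Type u) :
    Orthonormal ℂ (ellTwoBasis : P → EllTwo P) := by
  classical
  rw [orthonormal_iff_ite]
  intro i j
  unfold ellTwoBasis
  rw [lp.inner_single_left, lp.single_apply]
  simp [Pi.single_apply]

theorem orthonormal_ellTwoBasis_add {P : Type u} [AddMonoid P] [IsLeftCancelAdd P] (s : P) :
    Orthonormal ℂ (fun t : P => (ellTwoBasis (s + t) : EllTwo P)) :=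
  (orthonormal_ellTwoBasis P).comp (fun t => s + t) (add_right_injective s)

/-- The left regular (Fock) representation of a left cancellative monoid `P` on `ℓ²(P)`:
`fock s` is the isometry with `e_t ↦ e_{s + t}` (see `fock_basis`). -/
noncomputable def fock {P : Type u} [AddMonoid P] [IsLeftCancelAdd P] (s : P) :
    EllTwo P →L[ℂ] EllTwo P :=
  (orthonormal_ellTwoBasis_add s).orthogonalFamily.linearIsometry.toContinuousLinearMap

theorem fock_basis {P : Type u} [AddMonoid P] [IsLeftCancelAdd P] (s t : P) :
    fock s (ellTwoBasis t) = ellTwoBasis (s + t) := by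
  classical
  unfold fock
  have h : (ellTwoBasis t : EllTwo P) = lp.single 2 t (1 : ℂ) := by
    unfold ellTwoBasis
    congr
  rw [h]
  refine ((orthonormal_ellTwoBasis_add s).orthogonalFamily.linearIsometry_apply_single
    (1 : ℂ)).trans ?_
  simp

end Fock

/-- The nonselfadjoint semigroup algebra `𝒜(P)`: the norm closed algebra of operators on `ℓ²(P)`
generated by the operators `fock s`. -/
noncomputable def semigroupAlgebra (P : Type u) [AddMonoid P] [IsLeftCancelAdd P] :
    Subalgebra ℂ (EllTwo P →L[ℂ] EllTwo P) :=
  (Algebra.adjoin ℂ (Set.range (fock : P → EllTwo P →L[ℂ] EllTwo P))).topologicalClosure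

theorem fock_mem_semigroupAlgebra {P : Type u} [AddMonoid P] [IsLeftCancelAdd P] (s : P) :
    fock s ∈ semigroupAlgebra P :=
  Subalgebra.le_topologicalClosure _ (Algebra.subset_adjoin ⟨s, rfl⟩)

/-- The reduced group C*-algebra of the discrete group `G`: the C*-algebra of operators on `ℓ²(G)`
generated by the left regular representation. -/
noncomputable def reducedGroupCStarAlgebra (G : Type u) [AddGroup G] :
    StarSubalgebra ℂ (EllTwo G →L[ℂ] EllTwo G) :=
  (StarAlgebra.adjoin ℂ (Set.range (fock : G → EllTwo G →L[ℂ] EllTwo G))).topologicalClosure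

theorem fock_mem_reducedGroupCStarAlgebra {G : Type u} [AddGroup G] (g : G) :
    fock g ∈ reducedGroupCStarAlgebra G :=
  StarSubalgebra.le_topologicalClosure _ (StarAlgebra.subset_adjoin ℂ _ ⟨g, rfl⟩)

instance isClosed_reducedGroupCStarAlgebra (G : Type u) [AddGroup G] :
    IsClosed (reducedGroupCStarAlgebra G : Set (EllTwo G →L[ℂ] EllTwo G)) :=
  StarSubalgebra.isClosed_topologicalClosure _

/-- The C*-norm of a square matrix over a C*-algebra `B`. Mathlib's `CStarMatrix` asks for an order
on `B` making it a star-ordered ring; the norm does not depend on it (see `matrixNorm_eq`). -/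
noncomputable def matrixNorm {B : Type u} [NonUnitalCStarAlgebra B] {n : ℕ}
    (M : Matrix (Fin n) (Fin n) B) : ℝ :=
  letI : PartialOrder B := CStarAlgebra.spectralOrder B
  letI : StarOrderedRing B := CStarAlgebra.spectralOrderedRing B
  ‖(CStarMatrix.ofMatrix M : CStarMatrix (Fin n) (Fin n) B)‖

theorem matrixNorm_eq {B : Type u} [NonUnitalCStarAlgebra B] [PartialOrder B] [StarOrderedRing B]
    {n : ℕ} (M : Matrix (Fin n) (Fin n) B) :
    matrixNorm M = ‖(CStarMatrix.ofMatrix M : CStarMatrix (Fin n) (Fin n) B)‖ := rfl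

/-- A map from an operator algebra `A ⊆ B` to a C*-algebra `C` is completely isometric if all its
entrywise applications `M_n(A) → M_n(C)` are isometric; `M_n(A)` is normed as a subspace of
`M_n(B)`. (For a linear map, isometric means norm preserving.) -/
def IsCompletelyIsometric {B : Type u} [CStarAlgebra B] {A : Subalgebra ℂ B}
    {C : Type v} [NonUnitalCStarAlgebra C] (f : A →ₙₐ[ℂ] C) : Prop :=
  ∀ (n : ℕ) (M : Matrix (Fin n) (Fin n) A),
    matrixNorm (M.map f) = matrixNorm (M.map (fun a : A => (a : B)))

/-- `C` is generated, as a C*-algebra, by the range of `f`. -/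
def GeneratesCStar {A : Type u} [Ring A] [Algebra ℂ A]
    {C : Type v} [NonUnitalCStarAlgebra C] (f : A →ₙₐ[ℂ] C) : Prop :=
  (NonUnitalStarAlgebra.adjoin ℂ (Set.range f)).topologicalClosure = ⊤

/-- The C*-algebra `C`, together with `i : A → C`, is the C*-envelope of the operator algebra
`A ⊆ B`: the map `i` is a completely isometric homomorphism whose range generates `C`, and for
every completely isometric homomorphism `j : A → D` whose range generates the C*-algebra `D` there
is a unique surjective *-homomorphism `Φ : D → C` with `Φ ∘ j = i`. -/
structure IsCStarEnvelope {B : Type u} [CStarAlgebra B] (A : Subalgebra ℂ B)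
    {C : Type v} [NonUnitalCStarAlgebra C] (i : A →ₙₐ[ℂ] C) : Prop where
  isCompletelyIsometric : IsCompletelyIsometric i
  generates : GeneratesCStar i
  couniversal : ∀ (D : Type w) [NonUnitalCStarAlgebra D] (j : A →ₙₐ[ℂ] D),
    IsCompletelyIsometric j → GeneratesCStar j →
      ∃! Φ : D →⋆ₙₐ[ℂ] C, Function.Surjective Φ ∧ ∀ a : A, Φ (j a) = i a

/-! Since `G = S - S`, a single translation by an element of `S` moves any finitely many finitely
supported vectors of `ℓ²(G)` into `ℓ²(S)`. Operators on `ℓ²(G)` that commute with these translations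
and leave `ℓ²(S)` invariant therefore lose no norm on restriction, and neither do matrices of them
(`norm_matrixOperator_eq`). Hence an element of `𝒜(S)` has at most one such extension to `ℓ²(G)`,
existence passes to norm limits (`exists_isTranslationExtension`), and extension is a completely
isometric homomorphism `i`.

For couniversality, `C*(G)` is commutative and each `U_s` is unitary, so a character `ψ` of `C*(G)`
gives a contractive functional `ψ ∘ i`, unimodular on the `V_s`. Carried to `j(𝒜(S))` and extended
by Hahn-Banach, it becomes a state of `D`. A state of modulus one on a contraction is multiplicative
against it (`map_mul_of_norm_map_eq_one`), so this state is a character of `D`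
(`exists_character_extension`). Letting `ψ` vary gives a *-homomorphism from `D` to the continuous
functions on the spectrum of `C*(G)`, which Gelfand duality turns into `Φ`
(`exists_unique_starAlgHom_of_unimodular`). -/

/-! ### Unital contractive functionals and their multiplicative domain. -/

section States

variable {D : Type*} [CStarAlgebra D] {φ : D →L[ℂ] ℂ}

/-- The norm of `a + it` squared is at most `‖a‖² + t²`, while `|φ a + it|²` contains `t² + 2t Im
φ(a)`. A linear function of `t` that is bounded above must have slope zero. -/
theorem im_eq_zero_of_isSelfAdjoint (hφ : ∀ x, ‖φ x‖ ≤ ‖x‖) (h1 : φ 1 = 1) {a : D}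
    (ha : IsSelfAdjoint a) : (φ a).im = 0 := by
  have key : ∀ t : ℝ, 2 * t * (φ a).im ≤ ‖a‖ ^ 2 := by
    intro t
    have h : ‖φ (a + ((t : ℂ) * Complex.I) • (1 : D))‖ ^ 2 ≤ ‖a‖ ^ 2 + t ^ 2 := by
      have h2 : ‖a + ((t : ℂ) * Complex.I) • (1 : D)‖ ^ 2 ≤ ‖a‖ ^ 2 + t ^ 2 := by
        rw [sq, ← CStarRing.norm_star_mul_self]
        have : star (a + ((t : ℂ) * Complex.I) • (1 : D)) * (a + ((t : ℂ) * Complex.I) • (1 : D))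
            = a * a + ((t : ℂ) ^ 2) • (1 : D) := by
          simp only [star_add, ha.star_eq, star_smul, star_one, add_mul, mul_add, smul_mul_assoc,
            mul_smul_comm, one_mul, mul_one, smul_add, smul_smul]
          simp only [star_mul', RCLike.star_def, Complex.conj_ofReal, Complex.conj_I]
          have : (t : ℂ) * -Complex.I * (t * Complex.I) = t ^ 2 := by
            linear_combination (-(t : ℂ) ^ 2) * Complex.I_sq
          rw [mul_comm _ ((t : ℂ) * -Complex.I), this, mul_neg, neg_smul]
          abel
        rw [this]
        refine (norm_add_le _ _).trans ?_
        have h3 : ‖((t : ℂ) ^ 2) • (1 : D)‖ ≤ t ^ 2 := by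
          rw [norm_smul]
          have : ‖(1 : D)‖ ≤ 1 := by
            rcases subsingleton_or_nontrivial D with h | h
            · simp [Subsingleton.elim (1 : D) 0]
            · exact CStarRing.norm_one.le
          simpa using mul_le_mul_of_nonneg_left this (sq_nonneg t)
        have h4 : ‖a * a‖ ≤ ‖a‖ ^ 2 := by rw [sq]; exact norm_mul_le _ _
        linarith
      exact (pow_le_pow_left₀ (norm_nonneg _) (hφ _) 2).trans h2
    rw [map_add, map_smul, h1, ← Complex.normSq_eq_norm_sq, Complex.normSq_apply] at h
    simp at h
    nlinarith [mul_self_nonneg (φ a).re, mul_self_nonneg (φ a).im]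
  by_contra hne
  have := key ((‖a‖ ^ 2 + 1) / (2 * (φ a).im))
  rw [show 2 * ((‖a‖ ^ 2 + 1) / (2 * (φ a).im)) * (φ a).im = ‖a‖ ^ 2 + 1 by field_simp] at this
  linarith

theorem map_star_eq_conj (hφ : ∀ x, ‖φ x‖ ≤ ‖x‖) (h1 : φ 1 = 1) (a : D) :
    φ (star a) = star (φ a) := by
  have h2 := im_eq_zero_of_isSelfAdjoint hφ h1 (IsSelfAdjoint.add_star_self a)
  have h3 := im_eq_zero_of_isSelfAdjoint hφ h1 (a := Complex.I • (a - star a))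
    (by simp [isSelfAdjoint_iff, star_smul, ← smul_neg])
  simp only [map_add, map_sub, map_smul, Complex.add_im, smul_eq_mul, Complex.mul_im, Complex.I_re,
    Complex.I_im, Complex.sub_re, zero_mul, one_mul, zero_add] at h2 h3
  apply Complex.ext <;> simp <;> linarith

/-- With `b = a*a`, the order relation `0 ≤ ‖b‖ - b ≤ ‖b‖` bounds `|‖b‖ - φ b|` by `‖b‖`. -/
theorem re_map_star_mul_self_nonneg (hφ : ∀ x, ‖φ x‖ ≤ ‖x‖) (h1 : φ 1 = 1) (a : D) :
    0 ≤ (φ (star a * a)).re := by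
  let : PartialOrder D := CStarAlgebra.spectralOrder D
  let : StarOrderedRing D := CStarAlgebra.spectralOrderedRing D
  set b := star a * a
  have hb : 0 ≤ b := star_mul_self_nonneg a
  have h2 : ‖algebraMap ℝ D ‖b‖ - b‖ ≤ ‖algebraMap ℝ D ‖b‖‖ :=
    CStarAlgebra.norm_le_norm_of_nonneg_of_le
      (sub_nonneg.2 (IsSelfAdjoint.le_algebraMap_norm_self (.of_nonneg hb))) (sub_le_self _ hb)
  have h3 : ‖algebraMap ℝ D ‖b‖‖ ≤ ‖b‖ := by
    rcases subsingleton_or_nontrivial D with h | h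
    · rw [Subsingleton.elim (algebraMap ℝ D ‖b‖) 0]; simp
    · simp
  have h4 := (hφ (algebraMap ℝ D ‖b‖ - b)).trans (h2.trans h3)
  have h5 : φ (algebraMap ℝ D ‖b‖) = ‖b‖ := by
    rw [IsScalarTower.algebraMap_apply ℝ ℂ D, Algebra.algebraMap_eq_smul_one (A := D), map_smul, h1]
    simp
  rw [map_sub, h5] at h4
  have := (Complex.re_le_norm _).trans h4
  simp at this
  exact this

/-- Degenerate Cauchy-Schwarz: with `z = φ(xb)`, positivity at `x* - t z̄ b` bounds `2t|z|²` by `Re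
φ(xx*)` for all `t ≥ 0`. -/
theorem map_mul_eq_zero_of_re_le_zero (hφ : ∀ x, ‖φ x‖ ≤ ‖x‖) (h1 : φ 1 = 1) {b : D}
    (hb : (φ (star b * b)).re ≤ 0) (x : D) : φ (x * b) = 0 := by
  have key : ∀ t : ℝ, 0 ≤ t → 2 * t * ‖φ (x * b)‖ ^ 2 ≤ (φ (x * star x)).re := by
    intro t ht
    set z := φ (x * b) with hz
    set c : ℂ := -(t * star z) with hc
    have h := re_map_star_mul_self_nonneg hφ h1 (star x + c • b)
    have e : star (star x + c • b) * (star x + c • b) =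
        x * star x + c • (x * b) + star (c • (x * b)) + (star c * c) • (star b * b) := by
      simp only [star_add, star_star, star_smul, star_mul, add_mul, mul_add, smul_mul_assoc,
        mul_smul_comm, smul_add, smul_smul]
      rw [mul_comm c]
      abel
    rw [e] at h
    simp only [map_add, map_star_eq_conj hφ h1, map_smul, ← hz, smul_eq_mul] at h
    have e1 : (c * z) = ((-(t * ‖z‖ ^ 2) : ℝ) : ℂ) := by
      have := Complex.conj_mul' z
      simp only [hc, RCLike.star_def]
      push_cast
      linear_combination (-(t : ℂ)) * this
    have e2 : star c * c = ((‖c‖ ^ 2 : ℝ) : ℂ) := by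
      have := Complex.conj_mul' c
      simpa using this
    rw [e1, e2] at h
    simp only [Complex.add_re, RCLike.star_def, Complex.conj_ofReal, Complex.ofReal_re,
      Complex.re_ofReal_mul] at h
    nlinarith [mul_nonneg (sq_nonneg ‖c‖) (neg_nonneg.2 hb)]
  by_contra hne
  have hpos : 0 < ‖φ (x * b)‖ ^ 2 := by positivity
  have h0 := key 0 le_rfl
  have := key (((φ (x * star x)).re + 1) / (2 * ‖φ (x * b)‖ ^ 2)) (by
    refine div_nonneg ?_ (by positivity)
    linarith)
  rw [show 2 * (((φ (x * star x)).re + 1) / (2 * ‖φ (x * b)‖ ^ 2)) * ‖φ (x * b)‖ ^ 2 =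
    (φ (x * star x)).re + 1 by field_simp] at this
  linarith

/-- A contraction on which a state has modulus one lies in the right multiplicative domain. -/
theorem map_mul_of_norm_map_eq_one (hφ : ∀ x, ‖φ x‖ ≤ ‖x‖) (h1 : φ 1 = 1) {c : D}
    (hc : ‖c‖ ≤ 1) (hc1 : ‖φ c‖ = 1) (x : D) : φ (x * c) = φ x * φ c := by
  -- The variance of `c` is `φ(c*c) - |φ c|²`, whose real part is at most `1 - 1`, so the centred
  -- element is annihilated.
  have h := map_mul_eq_zero_of_re_le_zero hφ h1 (b := c - φ c • (1 : D)) ?_ x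
  · rw [mul_sub, map_sub, mul_smul_comm, mul_one, map_smul, smul_eq_mul, sub_eq_zero] at h
    rw [h, mul_comm]
  · have e : star (c - φ c • (1 : D)) * (c - φ c • (1 : D)) =
        star c * c - φ c • star c - star (φ c) • c + (star (φ c) * φ c) • (1 : D) := by
      simp only [star_sub, star_smul, star_one, sub_mul, mul_sub, smul_mul_assoc, mul_smul_comm,
        one_mul, mul_one, smul_sub, smul_smul]
      rw [mul_comm (star (φ c))]
      abel
    have e1 : star (φ c) * φ c = 1 := by
      have := Complex.conj_mul' (φ c)
      rw [hc1] at this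
      simpa using this
    have e2 : φ c * star (φ c) = 1 := by rw [mul_comm, e1]
    rw [e, map_add, map_sub, map_sub, map_smul, map_smul, map_smul, map_star_eq_conj hφ h1,
      smul_eq_mul, smul_eq_mul, smul_eq_mul, e1, e2, h1]
    have h5 : (φ (star c * c)).re ≤ 1 := by
      refine (Complex.re_le_norm _).trans ((hφ _).trans ?_)
      rw [CStarRing.norm_star_mul_self]
      nlinarith [norm_nonneg c]
    simp
    linarith

theorem map_mul_of_norm_map_eq_one' (hφ : ∀ x, ‖φ x‖ ≤ ‖x‖) (h1 : φ 1 = 1) {c : D}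
    (hc : ‖c‖ ≤ 1) (hc1 : ‖φ c‖ = 1) (x : D) : φ (c * x) = φ c * φ x := by
  have := map_mul_of_norm_map_eq_one hφ h1 (c := star c) (by simpa using hc)
    (by simpa [map_star_eq_conj hφ h1] using hc1) (star x)
  rw [← star_mul, map_star_eq_conj hφ h1, map_star_eq_conj hφ h1, map_star_eq_conj hφ h1,
    ← star_mul] at this
  exact star_injective this

end States

/-! ### Closed range of *-homomorphisms. -/

section ClosedRange

variable {A B : Type*} [NonUnitalCStarAlgebra A] [NonUnitalCStarAlgebra B]

theorem continuous_nonUnitalStarAlgHom (Φ : A →⋆ₙₐ[ℂ] B) : Continuous Φ :=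
  AddMonoidHomClass.continuous_of_bound Φ 1 fun a => by
    simpa using NonUnitalStarAlgHom.norm_apply_le Φ a

/-- Truncation to `[-r, r]` by functional calculus commutes with `Φ` and is the identity on the
spectrum of `Φ a`. -/
theorem exists_isSelfAdjoint_lift (Φ : A →⋆ₙₐ[ℂ] B) {a : A} (ha : IsSelfAdjoint a) :
    ∃ a' : A, Φ a' = Φ a ∧ ‖a'‖ ≤ ‖Φ a‖ := by
  set r := ‖Φ a‖
  have hr : 0 ≤ r := norm_nonneg _
  set f : ℝ → ℝ := fun x => max (-r) (min r x) with hf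
  have hfc : Continuous f := by fun_prop
  have hf0 : f 0 = 0 := by simp [hf, hr]
  have hb : IsSelfAdjoint (Φ a) := ha.map Φ
  refine ⟨cfcₙ f a, ?_, norm_cfcₙ_le fun x _ => ?_⟩
  · have hc : Continuous Φ := continuous_nonUnitalStarAlgHom Φ
    rw [NonUnitalStarAlgHomClass.map_cfcₙ (S := ℂ) Φ f a hfc.continuousOn hf0 hc ha hb]
    conv_rhs => rw [← cfcₙ_id ℝ (Φ a) hb]
    refine cfcₙ_congr fun x hx => ?_
    have hx' : ‖x‖ ≤ r := by
      have := (norm_cfcₙ_le_iff (id : ℝ → ℝ) (Φ a) r).1 (by rw [cfcₙ_id ℝ (Φ a) hb]) x hx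
      simpa using this
    rw [Real.norm_eq_abs, abs_le] at hx'
    simp [hf, hx'.1, hx'.2]
  · rw [Real.norm_eq_abs, abs_le]
    exact ⟨le_max_left _ _, max_le (by linarith) (min_le_left _ _)⟩

theorem exists_lift_norm_le (Φ : A →⋆ₙₐ[ℂ] B) (a : A) :
    ∃ a' : A, Φ a' = Φ a ∧ ‖a'‖ ≤ 2 * ‖Φ a‖ := by
  obtain ⟨x, hx, hxn⟩ := exists_isSelfAdjoint_lift Φ (realPart a).2
  obtain ⟨y, hy, hyn⟩ := exists_isSelfAdjoint_lift Φ (imaginaryPart a).2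
  refine ⟨x + Complex.I • y, ?_, ?_⟩
  · rw [map_add, map_smul, hx, hy, ← map_smul, ← map_add, realPart_add_I_smul_imaginaryPart]
  · have h1 : Φ (realPart a : A) = realPart (Φ a) := by
      rw [realPart_apply_coe, realPart_apply_coe,
        map_real_smul Φ (continuous_nonUnitalStarAlgHom Φ), map_add, map_star]
    have h2 : Φ (imaginaryPart a : A) = imaginaryPart (Φ a) := by
      rw [imaginaryPart_apply_coe, imaginaryPart_apply_coe, map_smul,
        map_real_smul Φ (continuous_nonUnitalStarAlgHom Φ), map_sub, map_star]
    rw [h1] at hxn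
    rw [h2] at hyn
    have h3 : ‖(realPart (Φ a) : B)‖ ≤ ‖Φ a‖ := realPart.norm_le (Φ a)
    have h4 : ‖(imaginaryPart (Φ a) : B)‖ ≤ ‖Φ a‖ := imaginaryPart.norm_le (Φ a)
    refine (norm_add_le _ _).trans ?_
    rw [norm_smul, Complex.norm_I, one_mul]
    linarith

/-- A *-homomorphism of C*-algebras with dense range is surjective. -/
theorem surjective_of_denseRange (Φ : A →⋆ₙₐ[ℂ] B) (hΦ : DenseRange Φ) :
    Function.Surjective Φ := by
  let f : NormedAddGroupHom A B :=
    { toFun := Φ, map_add' := map_add Φ,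
      bound' := ⟨1, fun a => by simpa using NonUnitalStarAlgHom.norm_apply_le Φ a⟩ }
  have h : f.SurjectiveOnWith f.range 2 := by
    rintro _ ⟨a, rfl⟩
    exact exists_lift_norm_le Φ a
  -- Lifts with norm control let an approximating series be summed in the complete algebra `A`, so
  -- every point of the closure is attained.
  have h2 := controlled_closure_of_complete (two_pos) one_pos h
  intro b
  have hb : b ∈ f.range.topologicalClosure := by
    have : b ∈ closure (Set.range Φ) := hΦ b
    exact this
  obtain ⟨a, ha, -⟩ := h2 b hb
  exact ⟨a, ha⟩

end ClosedRange

/-! ### Extending characters and constructing `Φ`. -/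

section Envelope

/-- A contractive idempotent of a C*-algebra is a projection. -/
theorem star_eq_self_of_isIdempotentElem {D : Type*} [NonUnitalCStarAlgebra D] {p : D}
    (hp : p * p = p) (h1 : ‖p‖ ≤ 1) : star p = p := by
  let : PartialOrder D := CStarAlgebra.spectralOrder D
  let : StarOrderedRing D := CStarAlgebra.spectralOrderedRing D
  have hp' : star p * star p = star p := by rw [← star_mul, hp]
  have r1 : ∀ x, p * (p * x) = p * x := fun x => by rw [← mul_assoc, hp]
  have r2 : ∀ x, star p * (star p * x) = star p * x := fun x => by rw [← mul_assoc, hp']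
  -- Here `u = (1 - p)p*p` is killed by `p`, so `p(p + tu) = p` and `p*p ≤ (p + tu)*(p + tu)`.
  -- Expanding, `2t cc* ≤ t² u*u`; letting `t → 0` gives `c = 0`, that is `p* = p*p`.
  set u := star p * p - p * (star p * p) with hu
  set c := star p - star p * p with hc
  have hpu : p * u = 0 := by rw [hu, mul_sub, r1, sub_self]
  have hk : star p * u = -(c * star c) := by
    simp only [hu, hc, star_sub, star_mul, star_star, mul_sub, sub_mul, mul_assoc, r2, hp]
    abel
  have key : ∀ t : ℝ, 0 < t → ‖c * star c‖ ≤ t * ‖star u * u‖ := by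
    intro t ht
    have h2 : star p * p ≤ star (p + t • u) * (p + t • u) := by
      have h3 := CStarAlgebra.star_left_conjugate_le_norm_smul (a := p + t • u) (b := star p * p)
      have h4 : p * (p + t • u) = p := by rw [mul_add, mul_smul_comm, hpu, smul_zero, add_zero, hp]
      have h5 : star (p + t • u) * (star p * p) * (p + t • u) = star p * p := by
        rw [mul_assoc, mul_assoc, h4, ← mul_assoc, ← star_mul, h4]
      rw [h5] at h3
      refine h3.trans ?_
      have h6 : ‖star p * p‖ ≤ 1 := by
        rw [CStarRing.norm_star_mul_self]; nlinarith [norm_nonneg p]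
      calc _ ≤ (1 : ℝ) • (star (p + t • u) * (p + t • u)) :=
            smul_le_smul_of_nonneg_right h6 (star_mul_self_nonneg _)
        _ = _ := one_smul _ _
    have hk' : star u * p = -(c * star c) := by
      have := congrArg star hk
      simpa using this
    have h3 : star (p + t • u) * (p + t • u) =
        star p * p + (t * t) • (star u * u) - (2 * t) • (c * star c) := by
      simp only [star_add, star_smul, add_mul, mul_add, smul_mul_assoc, mul_smul_comm, hk, hk',
        smul_add, smul_smul, star_trivial, two_mul, add_smul, smul_neg]
      abel
    rw [h3, add_sub_assoc, le_add_iff_nonneg_right, sub_nonneg] at h2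
    have h4 := CStarAlgebra.norm_le_norm_of_nonneg_of_le
      (smul_nonneg (by positivity) (mul_star_self_nonneg c)) h2
    rw [norm_smul, norm_smul, Real.norm_of_nonneg (by positivity),
      Real.norm_of_nonneg (by positivity)] at h4
    have h5 : 2 * ‖c * star c‖ ≤ t * ‖star u * u‖ := le_of_mul_le_mul_left (by linarith) ht
    linarith [norm_nonneg (c * star c)]
  have h0 : ‖c * star c‖ ≤ 0 := by
    refine le_of_forall_pos_le_add fun ε hε => ?_
    have hpos : 0 < ‖star u * u‖ + 1 := by positivity
    refine (key (ε / (‖star u * u‖ + 1)) (by positivity)).trans ?_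
    rw [zero_add, div_mul_eq_mul_div, div_le_iff₀ hpos]
    nlinarith
  have hc0 : c = 0 := by
    rw [CStarRing.norm_self_mul_star] at h0
    exact norm_eq_zero.1 (by nlinarith [norm_nonneg c])
  have h2 : star p = star p * p := sub_eq_zero.1 hc0
  have h3 := congrArg star h2
  rw [star_star, star_mul, star_star] at h3
  rw [h2, ← h3]

theorem GeneratesCStar.induction {A : Type u} [Ring A] [Algebra ℂ A] {C : Type v}
    [NonUnitalCStarAlgebra C] {f : A →ₙₐ[ℂ] C} (hf : GeneratesCStar f) {p : C → Prop}
    (mem : ∀ a, p (f a)) (add : ∀ x y, p x → p y → p (x + y))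
    (mul : ∀ x y, p x → p y → p (x * y)) (smul : ∀ (r : ℂ) x, p x → p (r • x))
    (star : ∀ x, p x → p (star x)) (closed : IsClosed {x | p x}) (x : C) : p x := by
  have hx : x ∈ (NonUnitalStarAlgebra.adjoin ℂ (Set.range f)).topologicalClosure := by
    rw [show _ = _ from hf]; trivial
  have h : ((NonUnitalStarAlgebra.adjoin ℂ (Set.range f) : Set C)) ⊆ {x | p x} := by
    intro y hy
    induction hy using NonUnitalStarAlgebra.adjoin_induction with
    | mem x hx => obtain ⟨a, rfl⟩ := hx; exact mem a
    | add x y _ _ hx hy => exact add x y hx hy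
    | zero => simpa using mem 0
    | mul x y _ _ hx hy => exact mul x y hx hy
    | smul r x _ hx => exact smul r x hx
    | star x _ hx => exact star x hx
  exact closure_minimal h closed hx

theorem GeneratesCStar.denseRange {A : Type u} [Ring A] [Algebra ℂ A] {C : Type v}
    [NonUnitalCStarAlgebra C] {f : A →ₙₐ[ℂ] C} (hf : GeneratesCStar f) {D : Type w}
    [NonUnitalCStarAlgebra D] (Φ : D →⋆ₙₐ[ℂ] C) (h : ∀ a, ∃ d, Φ d = f a) : DenseRange Φ := by
  have hc : (NonUnitalStarAlgHom.range Φ).topologicalClosure = ⊤ := by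
    refine top_le_iff.1 ?_
    rw [← show _ = _ from hf]
    refine NonUnitalStarSubalgebra.topologicalClosure_mono (NonUnitalStarAlgebra.adjoin_le ?_)
    rintro _ ⟨a, rfl⟩
    exact h a
  intro c
  have : c ∈ (NonUnitalStarAlgHom.range Φ).topologicalClosure := by rw [hc]; trivial
  exact this

/-- If a functional on an algebra generated by contractions is contractive, unital and unimodular
on the generators, then it extends to a character of any C*-algebra generated by an isometric copy
of the algebra. -/
theorem exists_character_extension_of_one {A : Type u} [NormedRing A] [NormedAlgebra ℂ A]
    {T : Set A} (hT : (Algebra.adjoin ℂ T).topologicalClosure = ⊤) (hT1 : ∀ a ∈ T, ‖a‖ ≤ 1)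
    {D : Type w} [CStarAlgebra D] {j : A →ₙₐ[ℂ] D} (hj : ∀ a, ‖j a‖ = ‖a‖) (hj1 : j 1 = 1)
    (hgen : GeneratesCStar j) {χ : A →L[ℂ] ℂ} (hχ : ∀ a, ‖χ a‖ ≤ ‖a‖) (hχ1 : χ 1 = 1)
    (hχT : ∀ a ∈ T, ‖χ a‖ = 1) : ∃ φ : D →⋆ₙₐ[ℂ] ℂ, ∀ a, φ (j a) = χ a := by
  let jl : A →ₗᵢ[ℂ] D := ⟨(j : A →ₗ[ℂ] D), hj⟩
  let e := jl.equivRange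
  -- Hahn-Banach on the isometric copy of `A`; norm preservation makes the extension contractive on
  -- all of `D`.
  obtain ⟨φ, hφe, hφn⟩ := exists_extension_norm_eq jl.toLinearMap.range
    (χ ∘L (e.symm.toContinuousLinearEquiv : jl.toLinearMap.range →L[ℂ] A))
  have hφj : ∀ a, φ (j a) = χ a := fun a => by
    have h := hφe (e a)
    rw [ContinuousLinearMap.comp_apply] at h
    exact h.trans (congrArg χ (e.symm_apply_apply a))
  have hφ : ∀ x, ‖φ x‖ ≤ ‖x‖ := by
    intro x
    refine (φ.le_of_opNorm_le (c := 1) ?_ x).trans (one_mul _).le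
    rw [hφn]
    refine ContinuousLinearMap.opNorm_le_bound _ zero_le_one fun y => ?_
    rw [one_mul]
    refine (hχ _).trans ?_
    exact (e.symm.norm_map y).le
  have h1 : φ 1 = 1 := by rw [← hj1, hφj, hχ1]
  have hjc : Continuous j := jl.continuous
  -- The elements against which `φ` is multiplicative on both sides form a closed subalgebra, and it
  -- contains the generators by unimodularity.
  have hjA : ∀ a x, φ (x * j a) = φ x * φ (j a) ∧ φ (j a * x) = φ (j a) * φ x := by
    intro a
    have ha : a ∈ (Algebra.adjoin ℂ T).topologicalClosure := by rw [hT]; trivial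
    have hs : (Algebra.adjoin ℂ T : Set A) ⊆
        {a | ∀ x, φ (x * j a) = φ x * φ (j a) ∧ φ (j a * x) = φ (j a) * φ x} := by
      intro b hb
      induction hb using Algebra.adjoin_induction with
      | mem c hc =>
        have h2 : ‖j c‖ ≤ 1 := (hj c).trans_le (hT1 c hc)
        have h3 : ‖φ (j c)‖ = 1 := by rw [hφj, hχT c hc]
        exact fun x => ⟨map_mul_of_norm_map_eq_one hφ h1 h2 h3 x,
          map_mul_of_norm_map_eq_one' hφ h1 h2 h3 x⟩
      | algebraMap r =>
        intro x
        simp [Algebra.algebraMap_eq_smul_one, hj1, h1, mul_comm]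
      | add x y _ _ hx hy =>
        intro z
        simp only [map_add, mul_add, add_mul, (hx z).1, (hx z).2, (hy z).1, (hy z).2, and_self]
      | mul x y _ _ hx hy =>
        intro z
        have hxy : φ (j x * j y) = φ (j x) * φ (j y) := (hx _).2
        refine ⟨?_, ?_⟩
        · rw [map_mul j, ← mul_assoc, (hy _).1, (hx _).1, hxy, mul_assoc]
        · rw [map_mul j, mul_assoc, (hx _).2, (hy _).2, hxy, mul_assoc]
    refine closure_minimal hs ?_ ha
    simp only [Set.ofPred_forall, Set.ofPred_and]
    exact isClosed_iInter fun x => (isClosed_eq (by fun_prop) (by fun_prop)).inter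
      (isClosed_eq (by fun_prop) (by fun_prop))
  -- The two-sided condition is also stable under adjoints, so it reaches the whole C*-algebra
  -- generated.
  have hall : ∀ d x, φ (x * d) = φ x * φ d ∧ φ (d * x) = φ d * φ x := by
    intro d
    refine hgen.induction (p := fun d => ∀ x, φ (x * d) = φ x * φ d ∧ φ (d * x) = φ d * φ x)
      hjA ?_ ?_ ?_ ?_ ?_ d
    · intro x y hx hy z
      simp only [map_add, mul_add, add_mul, (hx z).1, (hx z).2, (hy z).1, (hy z).2, and_self]
    · intro x y hx hy z
      refine ⟨?_, ?_⟩
      · rw [← mul_assoc, (hy _).1, (hx _).1, (hy _).1, mul_assoc]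
      · rw [mul_assoc, (hx _).2, (hy _).2, (hx _).2, mul_assoc]
    · intro r x hx z
      simp only [mul_smul_comm, smul_mul_assoc, map_smul, (hx z).1, (hx z).2, smul_eq_mul]
      exact ⟨by ring, by ring⟩
    · intro x hx z
      have h2 := hx (star z)
      rw [← star_star z, ← star_mul, ← star_mul]
      simp only [map_star_eq_conj hφ h1 (x * _), map_star_eq_conj hφ h1 (_ * x), h2.1, h2.2,
        star_mul', map_star_eq_conj hφ h1, star_star]
      exact ⟨mul_comm _ _, mul_comm _ _⟩
    · simp only [Set.ofPred_forall, Set.ofPred_and]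
      exact isClosed_iInter fun x => (isClosed_eq (by fun_prop) (by fun_prop)).inter
        (isClosed_eq (by fun_prop) (by fun_prop))
  exact ⟨{ toFun := φ
           map_smul' := fun r x => map_smul φ r x
           map_zero' := map_zero φ
           map_add' := map_add φ
           map_mul' := fun x y => (hall x y).2
           map_star' := map_star_eq_conj hφ h1 }, hφj⟩

/-- Reduction to the unital case: `j 1` is a contractive idempotent, hence self-adjoint. It is then
a unit for the adjoints of the generators as well, and so for `D`. -/
theorem exists_character_extension {A : Type u} [NormedRing A] [NormedAlgebra ℂ A]
    {T : Set A} (hT : (Algebra.adjoin ℂ T).topologicalClosure = ⊤) (hA : ‖(1 : A)‖ ≤ 1)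
    (hT1 : ∀ a ∈ T, ‖a‖ ≤ 1)
    {D : Type w} [NonUnitalCStarAlgebra D] {j : A →ₙₐ[ℂ] D} (hj : ∀ a, ‖j a‖ = ‖a‖)
    (hgen : GeneratesCStar j) {χ : A →L[ℂ] ℂ} (hχ : ∀ a, ‖χ a‖ ≤ ‖a‖) (hχ1 : χ 1 = 1)
    (hχT : ∀ a ∈ T, ‖χ a‖ = 1) : ∃ φ : D →⋆ₙₐ[ℂ] ℂ, ∀ a, φ (j a) = χ a := by
  have hidem : j 1 * j 1 = j 1 := by rw [← map_mul, one_mul]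
  have hstar : star (j 1) = j 1 := by
    refine star_eq_self_of_isIdempotentElem hidem ?_
    rwa [hj]
  have hunit : ∀ d, j 1 * d = d ∧ d * j 1 = d := by
    intro d
    refine hgen.induction (p := fun d => j 1 * d = d ∧ d * j 1 = d) ?_ ?_ ?_ ?_ ?_ ?_ d
    · intro a
      rw [← map_mul, ← map_mul, one_mul, mul_one]
      exact ⟨rfl, rfl⟩
    · intro x y hx hy
      rw [mul_add, add_mul, hx.1, hx.2, hy.1, hy.2]
      exact ⟨rfl, rfl⟩
    · intro x y hx hy
      rw [← mul_assoc, hx.1, mul_assoc, hy.2]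
      exact ⟨rfl, rfl⟩
    · intro r x hx
      rw [mul_smul_comm, smul_mul_assoc, hx.1, hx.2]
      exact ⟨rfl, rfl⟩
    · intro x hx
      rw [← hstar, ← star_mul, ← star_mul, hx.1, hx.2]
      exact ⟨rfl, rfl⟩
    · exact (isClosed_eq (by fun_prop) (by fun_prop)).inter
        (isClosed_eq (by fun_prop) (by fun_prop))
  let ring : NormedRing D :=
    { (inferInstance : NonUnitalNormedRing D) with
      one := j 1
      one_mul := fun d => (hunit d).1
      mul_one := fun d => (hunit d).2 }
  let inst : CStarAlgebra D :=
    { ring, ‹NonUnitalCStarAlgebra D› with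
      algebraMap :=
        { toFun := fun r => r • j 1
          map_one' := one_smul _ _
          map_mul' := fun r s => by
            rw [smul_mul_assoc, mul_smul_comm, hidem, smul_smul]
          map_zero' := zero_smul _ _
          map_add' := fun r s => add_smul _ _ _ }
      commutes' := fun r d => by
        change (r • j 1) * d = d * (r • j 1)
        rw [smul_mul_assoc, mul_smul_comm, (hunit d).1, (hunit d).2]
      smul_def' := fun r d => by
        change r • d = (r • j 1) * d
        rw [smul_mul_assoc, (hunit d).1]
      norm_smul_le := norm_smul_le }
  exact exists_character_extension_of_one (D := D) hT hT1 hj rfl hgen hχ hχ1 hχT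

/-- Each character of `C` yields one of `D`; together they give a map from `D` into the continuous
functions on the spectrum of `C`, to be composed with the inverse Gelfand transform. -/
theorem exists_unique_starAlgHom_of_unimodular {A : Type u} [NormedRing A] [NormedAlgebra ℂ A]
    {T : Set A} (hT : (Algebra.adjoin ℂ T).topologicalClosure = ⊤) (hA : ‖(1 : A)‖ ≤ 1)
    (hT1 : ∀ a ∈ T, ‖a‖ ≤ 1)
    {C : Type v} [CStarAlgebra C] (hcomm : ∀ x y : C, x * y = y * x) {i : A →ₙₐ[ℂ] C}
    (hi : ∀ a, ‖i a‖ = ‖a‖) (hi1 : i 1 = 1) (hiT : ∀ a ∈ T, star (i a) * i a = 1)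
    (higen : GeneratesCStar i)
    {D : Type w} [NonUnitalCStarAlgebra D] {j : A →ₙₐ[ℂ] D} (hj : ∀ a, ‖j a‖ = ‖a‖)
    (hgen : GeneratesCStar j) :
    ∃! Φ : D →⋆ₙₐ[ℂ] C, Function.Surjective Φ ∧ ∀ a : A, Φ (j a) = i a := by
  let inst : CommCStarAlgebra C := { ‹CStarAlgebra C› with mul_comm := hcomm }
  have hic : Continuous i :=
    AddMonoidHomClass.continuous_of_bound i 1 fun a => by rw [hi, one_mul]
  have hψ : ∀ ψ : WeakDual.characterSpace ℂ C, ∃ φ : D →⋆ₙₐ[ℂ] ℂ, ∀ a, φ (j a) = ψ (i a) := by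
    intro ψ
    have hstar : ∀ c, ψ (star c) = star (ψ c) := fun c => map_star ψ c
    have hle : ∀ c, ‖ψ c‖ ≤ ‖c‖ := fun c => NonUnitalStarAlgHom.norm_apply_le ψ c
    let χ : A →L[ℂ] ℂ :=
      { toFun := fun a => ψ (i a)
        map_add' := fun x y => by rw [map_add, map_add]
        map_smul' := fun r x => by rw [map_smul, map_smul]; rfl
        cont := (map_continuous ψ).comp hic }
    refine exists_character_extension hT hA hT1 hj hgen (χ := χ) (fun a => (hle _).trans_eq (hi a))
      ?_ ?_
    · change ψ (i 1) = 1
      rw [hi1, map_one]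
    · intro a ha
      change ‖ψ (i a)‖ = 1
      have h := congrArg ψ (hiT a ha)
      rw [map_mul, map_one, hstar] at h
      have h2 := congrArg norm h
      rw [norm_mul, norm_star, norm_one] at h2
      nlinarith [norm_nonneg (ψ (i a))]
  choose φ hφ using hψ
  -- On `j a` the function is the Gelfand transform of `i a`. Characters are contractive, so norm
  -- limits in `D` become uniform limits.
  have hcont : ∀ d, Continuous fun ψ => φ ψ d := by
    intro d
    refine hgen.induction (p := fun d => Continuous fun ψ => φ ψ d) ?_ ?_ ?_ ?_ ?_ ?_ d
    · intro a
      simp only [hφ]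
      exact (WeakDual.gelfandTransform ℂ C (i a)).continuous
    · intro x y hx hy
      simp only [map_add]
      exact hx.add hy
    · intro x y hx hy
      simp only [map_mul]
      exact hx.mul hy
    · intro r x hx
      simp only [map_smul]
      exact hx.const_smul r
    · intro x hx
      simpa only [map_star] using hx.star
    · refine isClosed_of_closure_subset fun x hx => ?_
      refine continuous_of_uniform_approx_of_continuous fun u hu => ?_
      obtain ⟨ε, hε, hεu⟩ := Metric.mem_uniformity_dist.1 hu
      obtain ⟨y, hy, hxy⟩ := Metric.mem_closure_iff.1 hx ε hε
      refine ⟨_, hy, fun ψ => hεu ?_⟩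
      rw [dist_eq_norm, ← map_sub]
      exact (NonUnitalStarAlgHom.norm_apply_le _ _).trans_lt (by rwa [← dist_eq_norm])
  let F : D →⋆ₙₐ[ℂ] C(WeakDual.characterSpace ℂ C, ℂ) :=
    { toFun := fun d => ⟨fun ψ => φ ψ d, hcont d⟩
      map_smul' := fun r x => by ext ψ; exact map_smul (φ ψ) r x
      map_zero' := by ext ψ; exact map_zero (φ ψ)
      map_add' := fun x y => by ext ψ; exact map_add (φ ψ) x y
      map_mul' := fun x y => by ext ψ; exact map_mul (φ ψ) x y
      map_star' := fun x => by ext ψ; exact map_star (φ ψ) x }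
  let Φ : D →⋆ₙₐ[ℂ] C :=
    ((gelfandStarTransform C).symm : C(WeakDual.characterSpace ℂ C, ℂ) →⋆ₙₐ[ℂ] C).comp F
  have hΦ : ∀ a, Φ (j a) = i a := by
    intro a
    have : F (j a) = gelfandStarTransform C (i a) := by
      ext ψ
      exact hφ ψ a
    change (gelfandStarTransform C).symm (F (j a)) = i a
    rw [this]
    exact (gelfandStarTransform C).symm_apply_apply _
  refine ⟨Φ, ⟨surjective_of_denseRange Φ (higen.denseRange Φ fun a => ⟨j a, hΦ a⟩), hΦ⟩, ?_⟩
  rintro Ψ ⟨-, hΨ⟩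
  ext d
  refine hgen.induction (p := fun d => Ψ d = Φ d) ?_ ?_ ?_ ?_ ?_ ?_ d
  · intro a
    rw [hΨ, hΦ]
  · intro x y hx hy
    rw [map_add, map_add, hx, hy]
  · intro x y hx hy
    rw [map_mul, map_mul, hx, hy]
  · intro r x hx
    rw [map_smul, map_smul, hx]
  · intro x hx
    rw [map_star, map_star, hx]
  · exact isClosed_eq (continuous_nonUnitalStarAlgHom Ψ) (continuous_nonUnitalStarAlgHom Φ)

end Envelope

/-! ### Matrix norms computed in a faithful representation. -/

section MatrixNorm

variable {H : Type*} [NormedAddCommGroup H] [InnerProductSpace ℂ H] {n : ℕ}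

/-- The operator on the direct sum `Hⁿ` given by a matrix of operators on `H`. -/
noncomputable def matrixOperator (M : Matrix (Fin n) (Fin n) (H →L[ℂ] H)) :
    PiLp 2 (fun _ : Fin n => H) →L[ℂ] PiLp 2 (fun _ : Fin n => H) :=
  ((PiLp.continuousLinearEquiv 2 ℂ (fun _ : Fin n => H)).symm :
      (Fin n → H) →L[ℂ] PiLp 2 (fun _ : Fin n => H)) ∘L
    (ContinuousLinearMap.pi fun k => ∑ l, M k l ∘L ContinuousLinearMap.proj l) ∘L
    (PiLp.continuousLinearEquiv 2 ℂ (fun _ : Fin n => H) :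
      PiLp 2 (fun _ : Fin n => H) →L[ℂ] (Fin n → H))

theorem matrixOperator_apply (M : Matrix (Fin n) (Fin n) (H →L[ℂ] H))
    (x : PiLp 2 (fun _ : Fin n => H)) (k : Fin n) :
    matrixOperator M x k = ∑ l, M k l (x l) := by
  simp [matrixOperator]

variable [CompleteSpace H]

theorem matrixOperator_star (M : Matrix (Fin n) (Fin n) (H →L[ℂ] H)) :
    matrixOperator (star M) = star (matrixOperator M) := by
  rw [ContinuousLinearMap.star_eq_adjoint, ContinuousLinearMap.eq_adjoint_iff]
  intro x y
  simp only [PiLp.inner_apply, matrixOperator_apply, sum_inner, inner_sum]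
  rw [Finset.sum_comm]
  refine Finset.sum_congr rfl fun k _ => Finset.sum_congr rfl fun l _ => ?_
  rw [Matrix.star_apply, ContinuousLinearMap.star_eq_adjoint,
    ContinuousLinearMap.adjoint_inner_left]

/-- A representation of a C*-algebra on `H` induces one of its matrix algebra on `Hⁿ`. -/
noncomputable def matrixRepresentation {C : Type*} [NonUnitalCStarAlgebra C]
    (π : C →⋆ₙₐ[ℂ] (H →L[ℂ] H)) (n : ℕ) :
    CStarMatrix (Fin n) (Fin n) C →⋆ₙₐ[ℂ]
      (PiLp 2 (fun _ : Fin n => H) →L[ℂ] PiLp 2 (fun _ : Fin n => H)) where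
  toFun M := matrixOperator (Matrix.map (CStarMatrix.ofMatrix.symm M) π)
  map_smul' r M := by
    ext x k
    simp [matrixOperator_apply, Finset.smul_sum]
  map_zero' := by
    ext x k
    simp [matrixOperator_apply]
  map_add' M N := by
    ext x k
    simp [matrixOperator_apply, Finset.sum_add_distrib]
  map_mul' M N := by
    ext x k
    simp only [matrixOperator_apply, mul_apply_eq_comp, Matrix.map_apply,
      CStarMatrix.ofMatrix_symm_apply, CStarMatrix.mul_apply, map_sum, map_mul,
      sum_apply]
    rw [Finset.sum_comm]
  map_star' M := by
    rw [← matrixOperator_star]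
    congr 1
    ext k l : 2
    simp [CStarMatrix.star_apply, Matrix.star_apply, map_star π]

/-- Injective *-homomorphisms of C*-algebras are isometric, so any faithful representation on `H`
computes the matrix norm on `Hⁿ`. -/
theorem matrixNorm_eq_norm_matrixOperator {C : Type v} [NonUnitalCStarAlgebra C]
    (π : C →⋆ₙₐ[ℂ] (H →L[ℂ] H)) (hπ : Function.Injective π) {n : ℕ}
    (M : Matrix (Fin n) (Fin n) C) : matrixNorm M = ‖matrixOperator (M.map π)‖ := by
  let : PartialOrder C := CStarAlgebra.spectralOrder C
  let : StarOrderedRing C := CStarAlgebra.spectralOrderedRing C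
  let : NonUnitalCStarAlgebra (CStarMatrix (Fin n) (Fin n) C) := {}
  rw [matrixNorm_eq]
  refine (NonUnitalStarAlgHom.norm_map (matrixRepresentation π n) ?_ _).symm
  intro M N h
  ext k l
  apply hπ
  ext x
  -- Testing on a vector supported in coordinate `l` and reading coordinate `k` isolates the entry.
  have h2 := congrArg (fun T => T (WithLp.toLp 2 (Pi.single l x)) k) h
  simp only [matrixRepresentation, NonUnitalStarAlgHom.coe_mk', NonUnitalAlgHom.coe_mk] at h2
  simpa [matrixRepresentation, matrixOperator_apply, Pi.single_apply, apply_ite] using h2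

theorem matrixNorm_singleton {B : Type u} [NonUnitalCStarAlgebra B] (b : B) :
    matrixNorm (Matrix.of fun _ _ : Fin 1 => b) = ‖b‖ := by
  let : PartialOrder B := CStarAlgebra.spectralOrder B
  let : StarOrderedRing B := CStarAlgebra.spectralOrderedRing B
  let : NonUnitalCStarAlgebra (CStarMatrix (Fin 1) (Fin 1) B) := {}
  rw [matrixNorm_eq]
  let e := CStarMatrix.toOneByOne (Fin 1) ℂ B
  let φ : B →⋆ₙₐ[ℂ] CStarMatrix (Fin 1) (Fin 1) B :=
    { toFun := e
      map_smul' := e.map_smul'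
      map_zero' := rfl
      map_add' := e.map_add'
      map_mul' := e.map_mul'
      map_star' := e.map_star' }
  exact NonUnitalStarAlgHom.norm_map φ e.injective b

theorem IsCompletelyIsometric.norm_map {B : Type u} [CStarAlgebra B] {A : Subalgebra ℂ B}
    {C : Type v} [NonUnitalCStarAlgebra C] {f : A →ₙₐ[ℂ] C} (hf : IsCompletelyIsometric f)
    (a : A) : ‖f a‖ = ‖a‖ := by
  have h := hf 1 (Matrix.of fun _ _ => a)
  rw [← matrixNorm_singleton (f a)]
  exact h.trans (matrixNorm_singleton (a : B))

end MatrixNorm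

/-! ### The basis of `ℓ²(P)` and the relations among translations. -/

section Basis

theorem hasSum_ellTwoBasis {P : Type u} (x : EllTwo P) :
    HasSum (fun p => (x p : ℂ) • ellTwoBasis p) x := by
  classical
  have h := lp.hasSum_single (p := 2) ENNReal.ofNat_ne_top x
  convert! h using 2 with p
  unfold ellTwoBasis
  rw [← lp.single_smul, smul_eq_mul, mul_one]

theorem dense_span_ellTwoBasis (P : Type u) :
    Dense (Submodule.span ℂ (Set.range (ellTwoBasis : P → EllTwo P)) : Set (EllTwo P)) := by
  intro x
  refine mem_closure_of_tendsto (hasSum_ellTwoBasis x) (Filter.Eventually.of_forall fun s => ?_)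
  exact Submodule.sum_mem _ fun p _ =>
    Submodule.smul_mem _ _ (Submodule.subset_span ⟨p, rfl⟩)

theorem ellTwo_clm_ext {P : Type u} {F : Type*} [NormedAddCommGroup F] [NormedSpace ℂ F]
    {T T' : EllTwo P →L[ℂ] F} (h : ∀ p, T (ellTwoBasis p) = T' (ellTwoBasis p)) : T = T' :=
  ContinuousLinearMap.ext_on (dense_span_ellTwoBasis P) (by rintro _ ⟨p, rfl⟩; exact h p)

theorem norm_fock_apply {P : Type u} [AddMonoid P] [IsLeftCancelAdd P] (s : P) (x : EllTwo P) :
    ‖fock s x‖ = ‖x‖ :=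
  (orthonormal_ellTwoBasis_add s).orthogonalFamily.linearIsometry.norm_map x

theorem norm_fock_le {P : Type u} [AddMonoid P] [IsLeftCancelAdd P] (s : P) :
    ‖(fock s : EllTwo P →L[ℂ] EllTwo P)‖ ≤ 1 :=
  ContinuousLinearMap.opNorm_le_bound _ zero_le_one fun x => by rw [norm_fock_apply, one_mul]

theorem fock_add {P : Type u} [AddMonoid P] [IsLeftCancelAdd P] (s t : P) :
    (fock (s + t) : EllTwo P →L[ℂ] EllTwo P) = fock s * fock t :=
  ellTwo_clm_ext fun p => by
    rw [mul_apply_eq_comp, fock_basis, fock_basis, fock_basis, add_assoc]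

theorem fock_zero {P : Type u} [AddMonoid P] [IsLeftCancelAdd P] :
    (fock (0 : P) : EllTwo P →L[ℂ] EllTwo P) = 1 :=
  ellTwo_clm_ext fun p => by rw [fock_basis, zero_add, one_apply_eq_self]

theorem star_fock_mul_fock {P : Type u} [AddMonoid P] [IsLeftCancelAdd P] (s : P) :
    star (fock s : EllTwo P →L[ℂ] EllTwo P) * fock s = 1 := by
  rw [ContinuousLinearMap.star_eq_adjoint]
  exact (ContinuousLinearMap.norm_map_iff_adjoint_comp_self _).1 (norm_fock_apply s)

theorem star_fock {G : Type u} [AddGroup G] (g : G) :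
    star (fock g : EllTwo G →L[ℂ] EllTwo G) = fock (-g) := by
  have h : (fock g : EllTwo G →L[ℂ] EllTwo G) * fock (-g) = 1 := by
    rw [← fock_add, add_neg_cancel, fock_zero]
  calc _ = star (fock g : EllTwo G →L[ℂ] EllTwo G) * (fock g * fock (-g)) := by rw [h, mul_one]
    _ = _ := by rw [← mul_assoc, star_fock_mul_fock, one_mul]

theorem fock_commute {P : Type u} [AddCommMonoid P] [IsLeftCancelAdd P] (s t : P) :
    Commute (fock s : EllTwo P →L[ℂ] EllTwo P) (fock t) := by
  rw [commute_iff_eq, ← fock_add, ← fock_add, add_comm]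

end Basis

/-! ### Translation-invariant extension from `ℓ²(S)` to `ℓ²(G)`. -/

section Regular

variable {G : Type u} [AddCommGroup G] (S : AddSubmonoid G)

/-- The inclusion `ℓ²(S) → ℓ²(G)`. -/
noncomputable def ellTwoInclusion : EllTwo S →ₗᵢ[ℂ] EllTwo G :=
  ((orthonormal_ellTwoBasis G).comp (Subtype.val : S → G)
    Subtype.val_injective).orthogonalFamily.linearIsometry

theorem ellTwoInclusion_basis (s : S) :
    ellTwoInclusion S (ellTwoBasis s) = ellTwoBasis (s : G) := by
  classical
  have h : (ellTwoBasis s : EllTwo S) = lp.single 2 s (1 : ℂ) := by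
    unfold ellTwoBasis
    congr
    exact Subsingleton.elim _ _
  rw [h]
  refine (((orthonormal_ellTwoBasis G).comp (Subtype.val : S → G)
    Subtype.val_injective).orthogonalFamily.linearIsometry_apply_single (1 : ℂ)).trans ?_
  simp

/-- `c` commutes with the translations by elements of `S`, leaves `ℓ²(S)` invariant, and restricts
to `T` there. -/
structure IsTranslationExtension (T : EllTwo S →L[ℂ] EllTwo S) (c : EllTwo G →L[ℂ] EllTwo G) :
    Prop where
  apply_inclusion : ∀ y, c (ellTwoInclusion S y) = ellTwoInclusion S (T y)
  commute : ∀ s : S, Commute c (fock (s : G))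

variable {S}

theorem fock_inclusion (s : S) (y : EllTwo S) :
    fock (s : G) (ellTwoInclusion S y) = ellTwoInclusion S (fock s y) := by
  have h : (fock (s : G)) ∘L (ellTwoInclusion S).toContinuousLinearMap =
      (ellTwoInclusion S).toContinuousLinearMap ∘L fock s := by
    refine ellTwo_clm_ext fun p => ?_
    simp only [ContinuousLinearMap.comp_apply, LinearIsometry.coe_toContinuousLinearMap,
      ellTwoInclusion_basis, fock_basis, AddSubmonoid.coe_add]
  exact congrArg (fun T => T y) h

theorem isTranslationExtension_fock (s : S) :
    IsTranslationExtension S (fock s) (fock (s : G)) :=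
  ⟨fock_inclusion s, fun _ => fock_commute _ _⟩

namespace IsTranslationExtension

variable {T T' : EllTwo S →L[ℂ] EllTwo S} {c c' : EllTwo G →L[ℂ] EllTwo G}

theorem add (h : IsTranslationExtension S T c) (h' : IsTranslationExtension S T' c') :
    IsTranslationExtension S (T + T') (c + c') :=
  ⟨fun y => by simp [h.apply_inclusion, h'.apply_inclusion],
    fun s => (h.commute s).add_left (h'.commute s)⟩

theorem mul (h : IsTranslationExtension S T c) (h' : IsTranslationExtension S T' c') :
    IsTranslationExtension S (T * T') (c * c') :=
  ⟨fun y => by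
    simp only [mul_apply_eq_comp, h.apply_inclusion, h'.apply_inclusion],
    fun s => (h.commute s).mul_left (h'.commute s)⟩

theorem smul (r : ℂ) (h : IsTranslationExtension S T c) :
    IsTranslationExtension S (r • T) (r • c) :=
  ⟨fun y => by simp [h.apply_inclusion], fun s => (h.commute s).smul_left r⟩

theorem sub (h : IsTranslationExtension S T c) (h' : IsTranslationExtension S T' c') :
    IsTranslationExtension S (T - T') (c - c') :=
  ⟨fun y => by simp [h.apply_inclusion, h'.apply_inclusion],
    fun s => (h.commute s).sub_left (h'.commute s)⟩

end IsTranslationExtension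

theorem isTranslationExtension_one :
    IsTranslationExtension S (1 : EllTwo S →L[ℂ] EllTwo S) (1 : EllTwo G →L[ℂ] EllTwo G) :=
  ⟨fun _ => rfl, fun _ => Commute.one_left _⟩

/-- Vectors of `ℓ²(G)` that some element of `S` translates into `ℓ²(S)`. -/
def translatableSubmodule (S : AddSubmonoid G) : Submodule ℂ (EllTwo G) where
  carrier := {x | ∃ (s : S) (y : EllTwo S), fock (s : G) x = ellTwoInclusion S y}
  add_mem' := by
    rintro x x' ⟨s, y, h⟩ ⟨s', y', h'⟩
    refine ⟨s + s', fock s' y + fock s y', ?_⟩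
    rw [map_add, map_add, ← fock_inclusion, ← fock_inclusion, ← h, ← h', AddSubmonoid.coe_add]
    congr 1
    · rw [add_comm, fock_add, mul_apply_eq_comp]
    · rw [fock_add, mul_apply_eq_comp]
  zero_mem' := ⟨0, 0, by simp⟩
  smul_mem' := by
    rintro r x ⟨s, y, h⟩
    exact ⟨s, r • y, by rw [map_smul, map_smul, h]⟩

theorem dense_translatableSubmodule (hS : IsPositiveCone S) :
    Dense (translatableSubmodule S : Set (EllTwo G)) := by
  refine (dense_span_ellTwoBasis G).mono (Submodule.span_le.2 ?_)
  rintro _ ⟨g, rfl⟩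
  obtain ⟨s, hs, t, ht, rfl⟩ := hS.exists_sub g
  refine ⟨⟨t, ht⟩, ellTwoBasis ⟨s, hs⟩, ?_⟩
  -- Translation by `t` carries `e_{s-t}` to `e_s`.
  rw [fock_basis, ellTwoInclusion_basis]
  simp

/-- The sum of the individual translations works for all vectors, because its remaining summands
preserve `ℓ²(S)`. -/
theorem exists_common_translation {n : ℕ} {x : Fin n → EllTwo G}
    (hx : ∀ k, x k ∈ translatableSubmodule S) :
    ∃ (s : S) (y : Fin n → EllTwo S), ∀ k, fock (s : G) (x k) = ellTwoInclusion S (y k) := by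
  choose s y h using hx
  refine ⟨∑ k, s k, fun k => fock (∑ l ∈ Finset.univ.erase k, s l) (y k), fun k => ?_⟩
  rw [← fock_inclusion, ← h, ← mul_apply_eq_comp, ← fock_add, ← AddSubmonoid.coe_add,
    Finset.sum_erase_add _ _ (Finset.mem_univ k)]

/-- Restriction to `ℓ²(S)ⁿ` gives one inequality. For the other, a dense set of vectors can be
shifted into `ℓ²(S)ⁿ` by an isometry that commutes with all entries of `c`. -/
theorem norm_matrixOperator_eq (hS : IsPositiveCone S) {n : ℕ}
    {T : Matrix (Fin n) (Fin n) (EllTwo S →L[ℂ] EllTwo S)}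
    {c : Matrix (Fin n) (Fin n) (EllTwo G →L[ℂ] EllTwo G)}
    (h : ∀ k l, IsTranslationExtension S (T k l) (c k l)) :
    ‖matrixOperator c‖ = ‖matrixOperator T‖ := by
  have hJ : ∀ (y : PiLp 2 fun _ : Fin n => EllTwo S) (x : PiLp 2 fun _ : Fin n => EllTwo G),
      (∀ k, x k = ellTwoInclusion S (y k)) → ‖x‖ = ‖y‖ := by
    intro y x hxy
    simp [PiLp.norm_eq_of_L2, hxy]
  have hcT : ∀ (y : PiLp 2 fun _ : Fin n => EllTwo S) (x : PiLp 2 fun _ : Fin n => EllTwo G),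
      (∀ k, x k = ellTwoInclusion S (y k)) → ‖matrixOperator c x‖ = ‖matrixOperator T y‖ := by
    intro y x hxy
    refine hJ _ _ fun k => ?_
    simp only [matrixOperator_apply, hxy, (h _ _).apply_inclusion, map_sum]
  refine le_antisymm ?_ ?_
  · have hd : Dense {x : PiLp 2 fun _ : Fin n => EllTwo G | ∀ k, x k ∈ translatableSubmodule S} := by
      have h1 : Dense (Set.pi Set.univ fun _ : Fin n => (translatableSubmodule S : Set (EllTwo G))) :=
        dense_pi _ fun _ _ => dense_translatableSubmodule hS
      have h2 := h1.preimage
        (PiLp.continuousLinearEquiv 2 ℂ (fun _ : Fin n => EllTwo G)).toHomeomorph.isOpenMap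
      exact h2.mono fun x hx k => Set.mem_univ_pi.1 hx k
    refine ContinuousLinearMap.opNorm_le_bound _ (norm_nonneg _) fun x => ?_
    refine hd.induction (P := fun x => ‖matrixOperator c x‖ ≤ ‖matrixOperator T‖ * ‖x‖) ?_
      (isClosed_le (matrixOperator c).continuous.norm (continuous_const.mul continuous_norm)) x
    intro x hx
    obtain ⟨s, y, hy⟩ := exists_common_translation hx
    let x' : PiLp 2 fun _ : Fin n => EllTwo G := WithLp.toLp 2 fun k => fock (s : G) (x k)
    let y' : PiLp 2 fun _ : Fin n => EllTwo S := WithLp.toLp 2 y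
    have h1 : ‖x'‖ = ‖x‖ := by simp [PiLp.norm_eq_of_L2, x', norm_fock_apply]
    have h2 : ‖matrixOperator c x'‖ = ‖matrixOperator c x‖ := by
      have h3 : ∀ k, matrixOperator c x' k = fock (s : G) (matrixOperator c x k) := by
        intro k
        simp only [matrixOperator_apply, map_sum, x']
        refine Finset.sum_congr rfl fun l _ => ?_
        exact congrArg (fun T => T (x l)) ((h k l).commute s).eq
      simp [PiLp.norm_eq_of_L2, h3, norm_fock_apply]
    rw [← h2, ← h1, hcT y' x' hy, hJ y' x' hy]
    exact ContinuousLinearMap.le_opNorm _ _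
  · refine ContinuousLinearMap.opNorm_le_bound _ (norm_nonneg _) fun y => ?_
    let x : PiLp 2 fun _ : Fin n => EllTwo G := WithLp.toLp 2 fun k => ellTwoInclusion S (y k)
    rw [← hcT y x fun _ => rfl, ← hJ y x fun _ => rfl]
    exact ContinuousLinearMap.le_opNorm _ _

theorem IsTranslationExtension.norm_eq (hS : IsPositiveCone S) {T : EllTwo S →L[ℂ] EllTwo S}
    {c : EllTwo G →L[ℂ] EllTwo G} (h : IsTranslationExtension S T c) : ‖c‖ = ‖T‖ := by
  have h1 := norm_matrixOperator_eq hS (T := Matrix.of fun _ _ : Fin 1 => T)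
    (c := Matrix.of fun _ _ : Fin 1 => c) fun _ _ => h
  have h2 := matrixNorm_eq_norm_matrixOperator (NonUnitalStarAlgHom.id ℂ (EllTwo G →L[ℂ] EllTwo G))
    Function.injective_id (Matrix.of fun _ _ : Fin 1 => c)
  have h3 := matrixNorm_eq_norm_matrixOperator (NonUnitalStarAlgHom.id ℂ (EllTwo S →L[ℂ] EllTwo S))
    Function.injective_id (Matrix.of fun _ _ : Fin 1 => T)
  rw [matrixNorm_singleton] at h2 h3
  rw [h2, h3]
  exact h1

/-- The difference extends zero and so has norm zero. This is what makes the chosen extensions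
linear and multiplicative. -/
theorem IsTranslationExtension.unique (hS : IsPositiveCone S) {T : EllTwo S →L[ℂ] EllTwo S}
    {c c' : EllTwo G →L[ℂ] EllTwo G} (h : IsTranslationExtension S T c)
    (h' : IsTranslationExtension S T c') : c = c' := by
  have := (h.sub h').norm_eq hS
  rw [sub_self, norm_zero] at this
  exact sub_eq_zero.1 (norm_eq_zero.1 this)

/-- Polynomials in the `V_s` extend explicitly; equality of norms makes the extensions of an
approximating sequence Cauchy in `C*(G)`. -/
theorem exists_isTranslationExtension (hS : IsPositiveCone S) (T : semigroupAlgebra S) :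
    ∃ c : reducedGroupCStarAlgebra G, IsTranslationExtension S (T : EllTwo S →L[ℂ] EllTwo S) c := by
  have hadj : ∀ T ∈ Algebra.adjoin ℂ (Set.range (fock : S → EllTwo S →L[ℂ] EllTwo S)),
      ∃ c : reducedGroupCStarAlgebra G, IsTranslationExtension S T c := by
    intro T hT
    induction hT using Algebra.adjoin_induction with
    | mem T hT =>
      obtain ⟨s, rfl⟩ := hT
      exact ⟨⟨_, fock_mem_reducedGroupCStarAlgebra (s : G)⟩, isTranslationExtension_fock s⟩
    | algebraMap r =>
      refine ⟨r • 1, ?_⟩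
      rw [Algebra.algebraMap_eq_smul_one]
      exact isTranslationExtension_one.smul r
    | add T T' _ _ h h' =>
      obtain ⟨c, h⟩ := h
      obtain ⟨c', h'⟩ := h'
      exact ⟨c + c', h.add h'⟩
    | mul T T' _ _ h h' =>
      obtain ⟨c, h⟩ := h
      obtain ⟨c', h'⟩ := h'
      exact ⟨c * c', h.mul h'⟩
  have hT : (T : EllTwo S →L[ℂ] EllTwo S) ∈ closure
      (Algebra.adjoin ℂ (Set.range (fock : S → EllTwo S →L[ℂ] EllTwo S)) : Set _) := T.2
  obtain ⟨u, hu, hlim⟩ := mem_closure_iff_seq_limit.1 hT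
  choose c hc using fun k => hadj (u k) (hu k)
  have hcau : CauchySeq c := by
    have hu' := hlim.cauchySeq
    rw [Metric.cauchySeq_iff] at hu' ⊢
    intro ε hε
    obtain ⟨N, hN⟩ := hu' ε hε
    refine ⟨N, fun m hm k hk => ?_⟩
    have := hN m hm k hk
    rw [dist_eq_norm] at this ⊢
    rw [← ((hc m).sub (hc k)).norm_eq hS] at this
    exact this
  obtain ⟨d, hd⟩ := cauchySeq_tendsto_of_complete hcau
  have hd' : Filter.Tendsto (fun k => (c k : EllTwo G →L[ℂ] EllTwo G)) Filter.atTop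
      (nhds (d : EllTwo G →L[ℂ] EllTwo G)) := (continuous_subtype_val.tendsto d).comp hd
  refine ⟨d, fun y => ?_, fun s => ?_⟩
  · have h1 : Filter.Tendsto (fun k => (c k : EllTwo G →L[ℂ] EllTwo G) (ellTwoInclusion S y))
        Filter.atTop (nhds ((d : EllTwo G →L[ℂ] EllTwo G) (ellTwoInclusion S y))) :=
      ((ContinuousLinearMap.apply ℂ (EllTwo G) (ellTwoInclusion S y)).continuous.tendsto _).comp hd'
    have h2 : Filter.Tendsto (fun k => ellTwoInclusion S (u k y)) Filter.atTop
        (nhds (ellTwoInclusion S ((T : EllTwo S →L[ℂ] EllTwo S) y))) :=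
      ((ellTwoInclusion S).continuous.tendsto _).comp
        (((ContinuousLinearMap.apply ℂ (EllTwo S) y).continuous.tendsto _).comp hlim)
    simp only [(hc _).apply_inclusion] at h1
    exact tendsto_nhds_unique h1 h2
  · have h1 := hd'.mul_const (fock (s : G))
    have h2 := hd'.const_mul (fock (s : G))
    simp only [((hc _).commute s).eq] at h1
    exact tendsto_nhds_unique h1 h2

/-- The canonical homomorphism `𝒜(S) → C*(G)`, mapping an operator on `ℓ²(S)` to its
translation invariant extension to `ℓ²(G)`. -/
noncomputable def semigroupAlgebraToGroup (hS : IsPositiveCone S) :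
    semigroupAlgebra S →ₙₐ[ℂ] reducedGroupCStarAlgebra G where
  toFun T := (exists_isTranslationExtension hS T).choose
  map_smul' r T := Subtype.ext <| (exists_isTranslationExtension hS (r • T)).choose_spec.unique hS
    ((exists_isTranslationExtension hS T).choose_spec.smul r)
  map_zero' := Subtype.ext <| (exists_isTranslationExtension hS 0).choose_spec.unique hS
    (by simpa using isTranslationExtension_one.smul (S := S) 0)
  map_add' T T' := Subtype.ext <| (exists_isTranslationExtension hS (T + T')).choose_spec.unique hS
    ((exists_isTranslationExtension hS T).choose_spec.add
      (exists_isTranslationExtension hS T').choose_spec)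
  map_mul' T T' := Subtype.ext <| (exists_isTranslationExtension hS (T * T')).choose_spec.unique hS
    ((exists_isTranslationExtension hS T).choose_spec.mul
      (exists_isTranslationExtension hS T').choose_spec)

/-! ### The canonical homomorphism and generation of `C*(G)`. -/

variable (hS : IsPositiveCone S)

theorem isTranslationExtension_semigroupAlgebraToGroup (T : semigroupAlgebra S) :
    IsTranslationExtension S (T : EllTwo S →L[ℂ] EllTwo S)
      (semigroupAlgebraToGroup hS T : EllTwo G →L[ℂ] EllTwo G) :=
  (exists_isTranslationExtension hS T).choose_spec

theorem semigroupAlgebraToGroup_fock (s : S) :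
    semigroupAlgebraToGroup hS ⟨fock s, fock_mem_semigroupAlgebra s⟩ =
      ⟨fock (s : G), fock_mem_reducedGroupCStarAlgebra (s : G)⟩ :=
  Subtype.ext <| (isTranslationExtension_semigroupAlgebraToGroup hS _).unique hS
    (isTranslationExtension_fock s)

theorem semigroupAlgebraToGroup_one : semigroupAlgebraToGroup hS 1 = 1 :=
  Subtype.ext <| (isTranslationExtension_semigroupAlgebraToGroup hS _).unique hS
    isTranslationExtension_one

theorem isCompletelyIsometric_semigroupAlgebraToGroup :
    IsCompletelyIsometric (semigroupAlgebraToGroup hS) := by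
  intro n M
  let π : reducedGroupCStarAlgebra G →⋆ₙₐ[ℂ] (EllTwo G →L[ℂ] EllTwo G) :=
    (reducedGroupCStarAlgebra G).subtype
  have hπ : Function.Injective π := Subtype.val_injective
  rw [matrixNorm_eq_norm_matrixOperator π hπ,
    matrixNorm_eq_norm_matrixOperator (NonUnitalStarAlgHom.id ℂ (EllTwo S →L[ℂ] EllTwo S))
      Function.injective_id]
  exact norm_matrixOperator_eq hS fun k l =>
    isTranslationExtension_semigroupAlgebraToGroup hS (M k l)

theorem generatesCStar_semigroupAlgebraToGroup :
    GeneratesCStar (semigroupAlgebraToGroup hS) := by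
  refine top_le_iff.1 fun c _ => ?_
  set N := NonUnitalStarAlgebra.adjoin ℂ (Set.range (semigroupAlgebraToGroup hS))
  -- The adjoin is non-unital, so the scalars must come from `i(1) = 1`.
  have hone : (1 : reducedGroupCStarAlgebra G) ∈ N :=
    NonUnitalStarAlgebra.subset_adjoin ℂ _ ⟨1, semigroupAlgebraToGroup_one hS⟩
  have hfock : ∀ s : S, (⟨fock (s : G), fock_mem_reducedGroupCStarAlgebra (s : G)⟩ :
      reducedGroupCStarAlgebra G) ∈ N := fun s =>
    NonUnitalStarAlgebra.subset_adjoin ℂ _ ⟨_, semigroupAlgebraToGroup_fock hS s⟩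
  have hadj : ∀ x ∈ StarAlgebra.adjoin ℂ (Set.range (fock : G → EllTwo G →L[ℂ] EllTwo G)),
      ∃ y ∈ N, (y : EllTwo G →L[ℂ] EllTwo G) = x := by
    intro x hx
    induction hx using StarAlgebra.adjoin_induction with
    | mem x hx =>
      obtain ⟨g, rfl⟩ := hx
      obtain ⟨s, hs, t, ht, rfl⟩ := hS.exists_sub g
      -- The unitary `U_{s-t}` factors as `U_s U_t*`, which is where adjoints are needed.
      refine ⟨_, mul_mem (hfock ⟨s, hs⟩) (star_mem (hfock ⟨t, ht⟩)), ?_⟩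
      change fock s * star (fock t) = fock (s - t)
      rw [star_fock, ← fock_add, sub_eq_add_neg]
    | algebraMap r =>
      refine ⟨r • 1, SMulMemClass.smul_mem r hone, ?_⟩
      rw [Algebra.algebraMap_eq_smul_one]
      rfl
    | add x y _ _ hx hy =>
      obtain ⟨x', hx, rfl⟩ := hx
      obtain ⟨y', hy, rfl⟩ := hy
      exact ⟨_, add_mem hx hy, rfl⟩
    | mul x y _ _ hx hy =>
      obtain ⟨x', hx, rfl⟩ := hx
      obtain ⟨y', hy, rfl⟩ := hy
      exact ⟨_, mul_mem hx hy, rfl⟩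
    | star x _ hx =>
      obtain ⟨x', hx, rfl⟩ := hx
      exact ⟨_, star_mem hx, rfl⟩
  have hc : (c : EllTwo G →L[ℂ] EllTwo G) ∈ closure
      (Subtype.val '' (N : Set (reducedGroupCStarAlgebra G))) :=
    closure_mono (fun x hx => hadj x hx) c.2
  exact closure_subtype.2 hc

theorem reducedGroupCStarAlgebra_mul_comm (x y : reducedGroupCStarAlgebra G) : x * y = y * x := by
  have h := StarAlgebra.isMulCommutative_adjoin ℂ
    (s := Set.range (fock : G → EllTwo G →L[ℂ] EllTwo G))
    (by rintro _ ⟨g, rfl⟩ _ ⟨h, rfl⟩; exact (fock_commute g h).eq)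
    (by rintro _ ⟨g, rfl⟩ _ ⟨h, rfl⟩; rw [star_fock]; exact (fock_commute g (-h)).eq)
  exact ((StarAlgebra.adjoin ℂ (Set.range fock)).commRingTopologicalClosure
    h.is_comm.comm).mul_comm x y

/-- Moves the density of polynomials from the ambient operator algebra into the normed algebra
`𝒜(P)` itself, the form the abstract extension result takes. -/
theorem topologicalClosure_adjoin_fock (P : Type u) [AddMonoid P] [IsLeftCancelAdd P] :
    (Algebra.adjoin ℂ (Set.range fun s : P =>
      (⟨fock s, fock_mem_semigroupAlgebra s⟩ : semigroupAlgebra P))).topologicalClosure = ⊤ := by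
  refine top_le_iff.1 fun a _ => ?_
  have hadj : ∀ x ∈ Algebra.adjoin ℂ (Set.range (fock : P → EllTwo P →L[ℂ] EllTwo P)),
      ∃ y ∈ Algebra.adjoin ℂ (Set.range fun s : P =>
      (⟨fock s, fock_mem_semigroupAlgebra s⟩ : semigroupAlgebra P)),
        (y : EllTwo P →L[ℂ] EllTwo P) = x := by
    intro x hx
    induction hx using Algebra.adjoin_induction with
    | mem x hx =>
      obtain ⟨s, rfl⟩ := hx
      exact ⟨_, Algebra.subset_adjoin ⟨s, rfl⟩, rfl⟩
    | algebraMap r => exact ⟨_, Subalgebra.algebraMap_mem _ r, rfl⟩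
    | add x y _ _ hx hy =>
      obtain ⟨x', hx, rfl⟩ := hx
      obtain ⟨y', hy, rfl⟩ := hy
      exact ⟨_, add_mem hx hy, rfl⟩
    | mul x y _ _ hx hy =>
      obtain ⟨x', hx, rfl⟩ := hx
      obtain ⟨y', hy, rfl⟩ := hy
      exact ⟨_, mul_mem hx hy, rfl⟩
  exact closure_subtype.2 (closure_mono (fun x hx => hadj x hx) a.2)

end Regular

theorem mainTheorem4 {G : Type u} [AddCommGroup G] (S : AddSubmonoid G) (hS : IsPositiveCone S) :
    ∃ i : semigroupAlgebra S →ₙₐ[ℂ] reducedGroupCStarAlgebra G,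
      (∀ s : S, i ⟨fock s, fock_mem_semigroupAlgebra s⟩ =
        ⟨fock (s : G), fock_mem_reducedGroupCStarAlgebra (s : G)⟩) ∧
      IsCStarEnvelope.{u, u, w} (semigroupAlgebra S) i := by
  refine ⟨semigroupAlgebraToGroup hS, semigroupAlgebraToGroup_fock hS,
    isCompletelyIsometric_semigroupAlgebraToGroup hS, generatesCStar_semigroupAlgebraToGroup hS,
    fun D _ j hj hgen => ?_⟩
  refine exists_unique_starAlgHom_of_unimodular (topologicalClosure_adjoin_fock S)
    ContinuousLinearMap.norm_id_le ?_
    reducedGroupCStarAlgebra_mul_comm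
    (isCompletelyIsometric_semigroupAlgebraToGroup hS).norm_map (semigroupAlgebraToGroup_one hS)
    ?_ (generatesCStar_semigroupAlgebraToGroup hS) hj.norm_map hgen
  · rintro _ ⟨s, rfl⟩
    exact norm_fock_le s
  · rintro _ ⟨s, rfl⟩
    rw [semigroupAlgebraToGroup_fock]
    exact Subtype.ext (star_fock_mul_fock (s : G))
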